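/- Let $n\ge 0$ and $r\ge 1$ be integers. For a partition $\lambda$ of $n$, let the least $r$-gap $g_r(\lambda)$ be the smallest positive integer that occurs fewer than $r$ times (possibly zero times) as a part of $\lambda$. Let $S_r(n)=\sum_{\lambda\vdash n} g_r(\lambda)$ be the sum of the least $r$-gaps over all partitions $\lambda$ of $n$, and let $U_r(n)$ be the number of partitions of $n$ none of whose parts is congruent to $0$, $r$ or $3r$ modulo $4r$. Then $S_r(n)$ and $U_r(n)$ have the same parity, that is, $S_r(n)\equiv U_r(n) \pmod 2$. -/

import Mathlib

/-- The least `r`-gap of a partition: the smallest positive integer that occurs fewer than `r`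
times as a part (the integer need not occur at all). For `r ≥ 1` such an integer always exists, see
`isLeast_leastRGap`; for `r = 0` there is none and the value is a default one. -/
noncomputable def leastRGap (r : ℕ) {n : ℕ} (p : Nat.Partition n) : ℕ :=
  sInf {k : ℕ | 1 ≤ k ∧ p.parts.count k < r}

theorem isLeast_leastRGap {r : ℕ} (hr : 1 ≤ r) {n : ℕ} (p : Nat.Partition n) :
    IsLeast {k : ℕ | 1 ≤ k ∧ p.parts.count k < r} (leastRGap r p) := by
  have hne : {k : ℕ | 1 ≤ k ∧ p.parts.count k < r}.Nonempty := by
    refine ⟨n + 1, by omega, ?_⟩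
    have h : n + 1 ∉ p.parts := fun h => by
      have := p.le_of_mem_parts h
      omega
    rw [Multiset.count_eq_zero_of_notMem h]
    omega
  exact ⟨Nat.sInf_mem hne, fun k hk => Nat.sInf_le hk⟩

/-- `S_r(n)`: the sum of the least `r`-gaps of all partitions of `n`. -/
noncomputable def sumLeastRGap (r n : ℕ) : ℕ :=
  ∑ p : Nat.Partition n, leastRGap r p

/-- `U_r(n)`: the number of partitions of `n` none of whose parts is congruent to
`0`, `r` or `3r` modulo `4r`. -/
def numRestrictedParts (r n : ℕ) : ℕ :=
  (Nat.Partition.restricted n fun i =>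
    ¬ (i ≡ 0 [MOD 4 * r] ∨ i ≡ r [MOD 4 * r] ∨ i ≡ 3 * r [MOD 4 * r])).card

/-! Counting the `k < g_r(λ)` amounts to counting the `k` for which `λ` contains `r` copies of each
of `1, …, k`. Removing these copies gives `∑ S_r(n) X^n = P(X) ∑_k q^(k(k+1)/2)`, with `q = X^r` and
`P` the partition generating function. Modulo 2, Gauss' identity turns the triangular series into `∏
(1 - q^(4m+1))(1 - q^(4m+3))(1 - q^(4m+4))`, which cancels from `P` exactly the parts congruent to
`r`, `3r`, `0` mod `4r`. Everything is done with finite products, up to a high power of `X`; Shanks'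
identity supplies the finite form. -/

open Finset in
/-- **Shanks' finite form of Gauss' triangular number identity**, with denominators cleared. -/
theorem shanks_triangular_identity {R : Type*} [CommRing R] (q : R) (n : ℕ) :
    (∏ m ∈ range n, (1 - q ^ (2 * m + 1))) * ∑ k ∈ range (2 * n), q ^ (k * (k + 1) / 2) =
      ∑ s ∈ range n, (∏ m ∈ Ico s n, (1 - q ^ (2 * m + 2))) *
        (∏ m ∈ range s, (1 - q ^ (2 * m + 1))) * q ^ (s * (2 * n + 1)) := by
  induction n with
  | zero => simp
  | succ n ih =>
    set D : ℕ → R := fun s => ∏ m ∈ range s, (1 - q ^ (2 * m + 1)) with hD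
    set E : ℕ → ℕ → R := fun s n => ∏ m ∈ Ico s n, (1 - q ^ (2 * m + 2)) with hE
    have hDs (s : ℕ) : D (s + 1) = D s * (1 - q ^ (2 * s + 1)) := prod_range_succ _ _
    have hEl {s : ℕ} (h : s < n) : E s n = (1 - q ^ (2 * s + 2)) * E (s + 1) n :=
      prod_eq_prod_Ico_succ_bot h _
    have hEr {s : ℕ} (h : s ≤ n) : E s (n + 1) = E s n * (1 - q ^ (2 * n + 2)) :=
      prod_Ico_succ_top h _
    -- Telescoping certificate for the step `n → n + 1`; the factor `1 - q ^ (2 * s)` makes `G 0 =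
    -- 0`.
    set G : ℕ → R := fun s => E s n * D s * (1 - q ^ (2 * s)) * q ^ (s * (2 * n + 1)) with hG
    have hstep : ∀ s ∈ range n, E s (n + 1) * D s * q ^ (s * (2 * (n + 1) + 1)) =
        (1 - q ^ (2 * n + 1)) * (E s n * D s * q ^ (s * (2 * n + 1))) + (G (s + 1) - G s) := by
      intro s hs
      have hs := mem_range.mp hs
      simp only [hG]
      rw [hEr hs.le, hDs, hEl hs]
      ring
    have hnn : E n n = 1 := by simp [hE]
    have e1 : 2 * n * (2 * n + 1) / 2 = n * (2 * n + 1) := by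
      rw [mul_assoc, Nat.mul_div_cancel_left _ two_pos]
    have e2 : (2 * n + 1) * (2 * n + 1 + 1) / 2 = (2 * n + 1) * (n + 1) := by
      rw [show (2 * n + 1) * (2 * n + 1 + 1) = 2 * ((2 * n + 1) * (n + 1)) by ring,
        Nat.mul_div_cancel_left _ two_pos]
    rw [sum_range_succ _ n, sum_congr rfl hstep, sum_add_distrib, sum_range_sub, ← mul_sum, ← ih,
      show 2 * (n + 1) = 2 * n + 1 + 1 by ring, sum_range_succ, sum_range_succ, e1, e2]
    change D (n + 1) * _ = _ + E n (n + 1) * D n * _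
    rw [hEr le_rfl, hDs]
    simp only [hG, hnn]
    simp only [mul_zero, pow_zero, sub_self, zero_mul, sub_zero]
    ring

open Finset PowerSeries in
/-- Jacobi's product for the triangular number series in characteristic two, up to a power of
`X`. -/
theorem X_pow_dvd_sum_triangular_sub_prod {R : Type*} [CommRing R] [CharP R 2] {r : ℕ} (hr : 1 ≤ r)
    {M : ℕ} (hM : 0 < M) :
    (X : R⟦X⟧) ^ (r * (2 * M + 1)) ∣ ∑ k ∈ range (4 * M), (X ^ r) ^ (k * (k + 1) / 2) -
      ∏ m ∈ range M, ((1 - (X ^ r) ^ (4 * m + 1)) * (1 - (X ^ r) ^ (4 * m + 3)) *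
        (1 - (X ^ r) ^ (4 * m + 4))) := by
  set q : R⟦X⟧ := X ^ r with hq
  have h2 : (2 : R⟦X⟧) = 0 := by
    rw [← map_ofNat (C (R := R)) 2, CharTwo.two_eq_zero, map_zero]
  set D : ℕ → R⟦X⟧ := fun s => ∏ m ∈ range s, (1 - q ^ (2 * m + 1)) with hD
  set F : R⟦X⟧ := ∏ m ∈ range M, (1 - q ^ (4 * m + 4)) with hF
  have hunit : IsUnit (D (2 * M)) := by
    rw [isUnit_iff_constantCoeff]
    simp [hD, hq, map_prod, Nat.one_le_iff_ne_zero.mp hr]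
  have hsplit (f : ℕ → R⟦X⟧) (M : ℕ) :
      ∏ m ∈ range (2 * M), f m = ∏ m ∈ range M, (f (2 * m) * f (2 * m + 1)) := by
    induction M with
    | zero => simp
    | succ M ih =>
      rw [show 2 * (M + 1) = 2 * M + 1 + 1 by ring, prod_range_succ, prod_range_succ, ih,
        prod_range_succ, mul_assoc]
  have hB : ∏ m ∈ range M, ((1 - q ^ (4 * m + 1)) * (1 - q ^ (4 * m + 3)) * (1 - q ^ (4 * m + 4))) =
      D (2 * M) * F := by
    rw [hD, hF, prod_mul_distrib]
    simp only [hsplit]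
    congr 1
    refine prod_congr rfl fun m _ => ?_
    ring
  -- Characteristic two enters here: `1 - q^(4m+2) = (1 - q^(2m+1))^2`.
  have hE : ∏ m ∈ range (2 * M), (1 - q ^ (2 * m + 2)) = D M ^ 2 * F := by
    rw [hD, hF, ← prod_pow, ← prod_mul_distrib, hsplit]
    refine prod_congr rfl fun m _ => ?_
    linear_combination (1 - q ^ (4 * m + 4)) * (q ^ (2 * m + 1) - q ^ (4 * m + 2)) * h2
  have hDD : q ^ (2 * M + 1) ∣ D (2 * M) - D M := by
    have h (j : ℕ) : q ^ (2 * M + 1) ∣ D (M + j) - D M := by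
      induction j with
      | zero => simp
      | succ j ih =>
        have : D (M + (j + 1)) - D M = D (M + j) - D M - D (M + j) * q ^ (2 * (M + j) + 1) := by
          rw [← add_assoc, hD]
          simp only [prod_range_succ]
          ring
        rw [this]
        exact dvd_sub ih (Dvd.dvd.mul_left (pow_dvd_pow _ (by omega)) _)
    simpa [two_mul] using h M
  have hS : q ^ (2 * M + 1) ∣ D (2 * M) * ∑ k ∈ range (4 * M), q ^ (k * (k + 1) / 2) -
      D M ^ 2 * F := by
    have h := shanks_triangular_identity q (2 * M)
    rw [show 2 * (2 * M) = 4 * M by ring] at h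
    rw [hD]
    dsimp only
    -- The `s = 0` term of Shanks' sum is the product in `hE`; the others are divisible by
    -- `q^(4M+1)`.
    rw [h, ← hE, ← Nat.sub_one_add_one (Nat.mul_pos two_pos hM).ne', sum_range_succ']
    simp only [range_zero, prod_empty, Nat.Ico_zero_eq_range, zero_mul, pow_zero, mul_one,
      add_sub_cancel_right]
    refine dvd_sum fun s _ => Dvd.dvd.mul_left (pow_dvd_pow _ ?_) _
    calc 2 * M - 1 + 1 + 1 ≤ 1 * (4 * M + 1) := by omega
      _ ≤ (s + 1) * (4 * M + 1) := Nat.mul_le_mul_right _ (by omega)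
  rw [pow_mul, ← hq, hB, ← hunit.dvd_mul_left]
  have : D (2 * M) * (∑ k ∈ range (4 * M), q ^ (k * (k + 1) / 2) - D (2 * M) * F) =
      (D (2 * M) * ∑ k ∈ range (4 * M), q ^ (k * (k + 1) / 2) - D M ^ 2 * F) -
        (D (2 * M) - D M) * ((D (2 * M) + D M) * F) := by ring
  rw [this]
  exact dvd_sub hS (hDD.mul_right _)

/-- Removing a multiset of positive integers from the partitions containing it. -/
theorem Nat.Partition.card_le_parts {M : Multiset ℕ} (hM : ∀ i ∈ M, 0 < i) (n : ℕ) :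
    (Finset.univ.filter fun p : n.Partition => M ≤ p.parts).card =
      if M.sum ≤ n then Fintype.card (n - M.sum).Partition else 0 := by
  split_ifs with h
  · refine Finset.card_bij' (t := Finset.univ)
      (fun p hp => ⟨p.parts - M,
        fun hi => p.parts_pos (Multiset.mem_of_le (Multiset.sub_le_self _ _) hi), ?_⟩)
      (fun p _ => ⟨p.parts + M, ?_, ?_⟩) ?_ ?_ ?_ ?_
    · have h1 := congrArg Multiset.sum (Multiset.sub_add_cancel (Finset.mem_filter.mp hp).2)
      rw [Multiset.sum_add, p.parts_sum] at h1
      omega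
    · intro i hi
      rcases Multiset.mem_add.mp hi with hi | hi
      exacts [p.parts_pos hi, hM i hi]
    · rw [Multiset.sum_add, p.parts_sum]
      omega
    · simp
    · simp
    · intro p hp
      ext1
      exact Multiset.sub_add_cancel (Finset.mem_filter.mp hp).2
    · intro p _
      ext1
      simp
  · rw [Finset.card_eq_zero, Finset.filter_eq_empty_iff]
    intro p _ hp
    obtain ⟨c, hc⟩ := Multiset.le_iff_exists_add.mp hp
    have := p.parts_sum
    rw [hc, Multiset.sum_add] at this
    omega

/-- The multiset in which each of `1, …, k` occurs `r` times. -/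
def staircase (r k : ℕ) : Multiset ℕ :=
  ∑ j ∈ Finset.Icc 1 k, Multiset.replicate r j

theorem count_staircase (r k i : ℕ) :
    (staircase r k).count i = if 1 ≤ i ∧ i ≤ k then r else 0 := by
  simp [staircase, Multiset.count_sum', Multiset.count_replicate]

theorem sum_staircase (r k : ℕ) : (staircase r k).sum = r * (k * (k + 1) / 2) := by
  have h : (staircase r k).sum = r * ∑ j ∈ Finset.range (k + 1), j := by
    rw [Finset.sum_range_succ', add_zero, Finset.mul_sum, staircase,
      ← Finset.Ico_add_one_right_eq_Icc, Finset.sum_Ico_eq_sum_range]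
    change Multiset.sumAddMonoidHom _ = _
    rw [map_sum]
    simp [add_comm]
  rw [h, Finset.sum_range_id, Nat.add_sub_cancel, mul_comm k]

theorem lt_leastRGap_iff {r : ℕ} (hr : 1 ≤ r) {n : ℕ} (p : n.Partition) (k : ℕ) :
    k < leastRGap r p ↔ staircase r k ≤ p.parts := by
  obtain ⟨h1, h2⟩ := isLeast_leastRGap hr p
  rw [Multiset.le_iff_count]
  simp only [count_staircase]
  constructor
  · intro h i
    split_ifs with hi
    · by_contra hc
      have := h2 ⟨hi.1, not_le.mp hc⟩
      omega
    · simp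
  · intro h
    by_contra hc
    have := h (leastRGap r p)
    rw [if_pos ⟨h1.1, not_lt.mp hc⟩] at this
    exact absurd h1.2 (not_lt.mpr this)

theorem leastRGap_le {r : ℕ} (hr : 1 ≤ r) {n : ℕ} (p : n.Partition) : leastRGap r p ≤ n + 1 := by
  refine (isLeast_leastRGap hr p).2 ⟨by omega, ?_⟩
  rw [Multiset.count_eq_zero_of_notMem fun h => ?_]
  · omega
  · have := p.le_of_mem_parts h
    omega

/-- Write each gap as the number of `k` below it and swap the sums; `K ≥ n + 1` suffices since no
gap exceeds `n + 1`. -/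
theorem sumLeastRGap_eq {r : ℕ} (hr : 1 ≤ r) {n K : ℕ} (hK : n + 1 ≤ K) :
    sumLeastRGap r n = ∑ k ∈ Finset.range K, if r * (k * (k + 1) / 2) ≤ n then
      Fintype.card (n - r * (k * (k + 1) / 2)).Partition else 0 := by
  have h (p : n.Partition) :
      leastRGap r p = ∑ k ∈ Finset.range K, if staircase r k ≤ p.parts then 1 else 0 := by
    simp only [← lt_leastRGap_iff hr]
    rw [← Finset.card_filter]
    have := leastRGap_le hr p
    rw [show (Finset.range K).filter (· < leastRGap r p) = Finset.range (leastRGap r p) by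
      ext k; simp only [Finset.mem_filter, Finset.mem_range]; omega, Finset.card_range]
  rw [sumLeastRGap, Finset.sum_congr rfl fun p _ => h p, Finset.sum_comm]
  refine Finset.sum_congr rfl fun k _ => ?_
  rw [← Finset.card_filter, Nat.Partition.card_le_parts, sum_staircase]
  intro i hi
  rw [← Multiset.count_pos, count_staircase] at hi
  by_contra hc
  simp [show i = 0 by omega] at hi

open PowerSeries in
theorem natCast_sumLeastRGap_eq_coeff {R : Type*} [CommRing R] {r : ℕ} (hr : 1 ≤ r) {n K : ℕ}
    (hK : n + 1 ≤ K) :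
    (sumLeastRGap r n : R) = coeff n ((PowerSeries.mk fun n => (Fintype.card n.Partition : R)) *
      ∑ k ∈ Finset.range K, (X ^ r) ^ (k * (k + 1) / 2)) := by
  rw [sumLeastRGap_eq hr hK, Finset.mul_sum, map_sum, Nat.cast_sum]
  refine Finset.sum_congr rfl fun k _ => ?_
  rw [← pow_mul, coeff_mul_X_pow']
  simp

open PowerSeries PowerSeries.WithPiTopology Filter in
/-- Deleting the factors of the parts violating `p` from the generating function of all
partitions. -/
theorem coeff_mk_card_partition_mul_prod {R : Type*} [CommRing R] (p : ℕ → Prop) [DecidablePred p]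
    (n : ℕ) : ∀ᶠ N in atTop, coeff n ((PowerSeries.mk fun n => (Fintype.card n.Partition : R)) *
        ∏ i ∈ Finset.range N, if p (i + 1) then (1 : R⟦X⟧) else 1 - X ^ (i + 1)) =
      ((Nat.Partition.restricted n p).card : R) := by
  -- In the discrete topology, convergence of a coefficient means that it is eventually constant.
  let _ : TopologicalSpace R := ⊥
  have _ : DiscreteTopology R := ⟨rfl⟩
  have hP := Nat.Partition.hasProd_powerSeriesMk_card_restricted R (fun _ => True)
  have hU := Nat.Partition.hasProd_powerSeriesMk_card_restricted R p
  have hB : Multipliable fun i => if p (i + 1) then (1 : R⟦X⟧) else 1 - X ^ (i + 1) := by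
    have h : Tendsto (fun i => (if p (i + 1) then (0 : R⟦X⟧) else - X ^ (i + 1)).order) atTop
        (nhds ⊤) := by
      refine ENat.tendsto_nhds_top_iff_natCast_lt.mpr fun m => eventually_atTop.mpr ⟨m, ?_⟩
      intro i hi
      nontriviality R using Subsingleton.eq_zero (α := R⟦X⟧)
      split_ifs
      · simp
      · rw [order_neg, order_X_pow]
        exact_mod_cast Nat.lt_succ_of_le hi
    refine (multipliable_one_add_of_tendsto_order_atTop_nhds_top R h).congr fun i => ?_
    split_ifs <;> simp [sub_eq_add_neg]
  have hmul := hP.mul hB.hasProd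
  have hterm (i : ℕ) : (if True then ∑' j : ℕ, (X : R⟦X⟧) ^ ((i + 1) * j) else 1) *
      (if p (i + 1) then (1 : R⟦X⟧) else 1 - X ^ (i + 1)) =
      if p (i + 1) then ∑' j : ℕ, (X : R⟦X⟧) ^ ((i + 1) * j) else 1 := by
    rw [if_pos trivial]
    split_ifs
    · simp
    · simp_rw [pow_mul]
      exact tsum_pow_mul_one_sub_of_constantCoeff_eq_zero (by simp)
  simp only [hterm] at hmul
  have hlim := (hB.hasProd.tendsto_prod_nat.const_mul
    (PowerSeries.mk fun n => (Fintype.card n.Partition : R)))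
  have heq : (PowerSeries.mk fun n => (Fintype.card n.Partition : R)) * ∏' i, (if p (i + 1) then
      (1 : R⟦X⟧) else 1 - X ^ (i + 1)) = PowerSeries.mk fun n =>
        ((Nat.Partition.restricted n p).card : R) := by
    rw [hU.unique hmul]
    simp [Nat.Partition.restricted]
  rw [heq, tendsto_iff_coeff_tendsto] at hlim
  have := hlim n
  rw [nhds_discrete, tendsto_pure] at this
  simpa only [coeff_mk] using this

open PowerSeries in
-- Each block of `4r` consecutive exponents contributes only its `r`-th, `3r`-th and `4r`-th
-- factors.
theorem prod_range_eq_prod_range_triple {R : Type*} [CommRing R] {r : ℕ} (hr : 1 ≤ r) (M : ℕ) :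
    (∏ i ∈ Finset.range (4 * r * M), if ¬ (i + 1 ≡ 0 [MOD 4 * r] ∨ i + 1 ≡ r [MOD 4 * r] ∨
        i + 1 ≡ 3 * r [MOD 4 * r]) then (1 : R⟦X⟧) else 1 - X ^ (i + 1)) =
      ∏ m ∈ Finset.range M, ((1 - (X ^ r) ^ (4 * m + 1)) * (1 - (X ^ r) ^ (4 * m + 3)) *
        (1 - (X ^ r) ^ (4 * m + 4))) := by
  induction M with
  | zero => simp
  | succ M ih =>
    rw [Nat.mul_succ, Finset.prod_range_add, ih, Finset.prod_range_succ]
    congr 1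
    have key : ∀ x ∈ Finset.range (4 * r), (¬ (4 * r * M + x + 1 ≡ 0 [MOD 4 * r] ∨
        4 * r * M + x + 1 ≡ r [MOD 4 * r] ∨ 4 * r * M + x + 1 ≡ 3 * r [MOD 4 * r])) ↔
        x ∉ ({r - 1, 3 * r - 1, 4 * r - 1} : Finset ℕ) := by
      intro x hx
      have hx := Finset.mem_range.mp hx
      simp only [Nat.ModEq, add_assoc, Nat.mul_add_mod, Finset.mem_insert, Finset.mem_singleton]
      rw [Nat.zero_mod, Nat.mod_eq_of_lt (show r < 4 * r by omega),
        Nat.mod_eq_of_lt (show 3 * r < 4 * r by omega)]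
      rcases Nat.lt_or_ge (x + 1) (4 * r) with h | h
      · rw [Nat.mod_eq_of_lt h]
        omega
      · rw [show x + 1 = 4 * r by omega, Nat.mod_self]
        omega
    have hsub : ({r - 1, 3 * r - 1, 4 * r - 1} : Finset ℕ) ⊆ Finset.range (4 * r) := by
      intro x
      simp only [Finset.mem_insert, Finset.mem_singleton, Finset.mem_range]
      omega
    rw [Finset.prod_congr rfl fun x hx => if_congr (key x hx) rfl rfl]
    rw [← Finset.prod_subset hsub fun x _ hx => if_pos hx]
    rw [Finset.prod_congr rfl fun x hx => if_neg (not_not.mpr hx)]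
    rw [Finset.prod_insert (by simp; omega), Finset.prod_insert (by simp; omega),
      Finset.prod_singleton, ← mul_assoc]
    simp only [← pow_mul]
    rw [show 4 * r * M + (r - 1) + 1 = r * (4 * M + 1) by
        rw [add_assoc, Nat.sub_add_cancel hr]; ring,
      show 4 * r * M + (3 * r - 1) + 1 = r * (4 * M + 3) by
        rw [add_assoc, Nat.sub_add_cancel (by omega)]; ring,
      show 4 * r * M + (4 * r - 1) + 1 = r * (4 * M + 4) by
        rw [add_assoc, Nat.sub_add_cancel (by omega)]; ring]

open PowerSeries in
theorem mainTheorem7 (n r : ℕ) (hr : 1 ≤ r) :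
    sumLeastRGap r n ≡ numRestrictedParts r n [MOD 2] := by
  rw [← ZMod.natCast_eq_natCast_iff]
  obtain ⟨N, hN⟩ := Filter.eventually_atTop.mp (coeff_mk_card_partition_mul_prod (R := ZMod 2)
    (fun i => ¬ (i ≡ 0 [MOD 4 * r] ∨ i ≡ r [MOD 4 * r] ∨ i ≡ 3 * r [MOD 4 * r])) n)
  -- Large enough for the product to have stabilised (`N ≤ 4rM`) and for the error to miss degree
  -- `n` (`n < r(2M+1)`).
  set M := max N (n + 1) with hM
  have hMr : M ≤ r * M := Nat.le_mul_of_pos_left M hr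
  have hle : N ≤ 4 * r * M := by
    rw [mul_assoc]
    omega
  have hU := hN _ hle
  rw [prod_range_eq_prod_range_triple hr] at hU
  rw [numRestrictedParts, ← hU, natCast_sumLeastRGap_eq_coeff hr (show n + 1 ≤ 4 * M by omega),
    ← sub_eq_zero, ← map_sub, ← mul_sub]
  refine X_pow_dvd_iff.mp (Dvd.dvd.mul_left
    (X_pow_dvd_sum_triangular_sub_prod hr (show 0 < M by omega)) _) n ?_
  rw [mul_add, mul_left_comm]
  omega
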